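/- Let $\nu>0$ and $\rho>0$, and let $\mathcal M$ be a Poisson random measure on $\mathbb R$ with rate $\nu$ on a probability space $(\Omega,\mathscr A,\mathbb P)$: its values on pairwise disjoint Borel sets are independent, and for a bounded Borel set $B$ the value $\mathcal M(B)$ is Poisson distributed with mean $\nu$ times the Lebesgue measure of $B$. For $N\in\mathbb N=\{1,2,\dots\}$ put $L_N=N/\rho$ and $\Lambda_N=(-L_N/2,L_N/2)$. Almost surely the atoms of $\mathcal M$ can be labeled as $\dots<\hat x_{-1}<\hat x_0<0<\hat x_1<\hat x_2<\dots$, and only finitely many of the intervals $(\hat x_i,\hat x_{i+1})\cap\Lambda_N$, $i\in\mathbb Z$, are nonempty; call these nonempty intervals the gaps in $\Lambda_N$, and let $l_N^{(1)}\ge l_N^{(2)}\ge\cdots$ be their lengths in decreasing order, repeated according to multiplicity. Then for every $\varepsilon>0$ and every $\hat c>0$ there is a $j\in\mathbb N$ such that, for all but finitely many $N\in\mathbb N$, with probability at least $1-\varepsilon$ there are at least $j$ gaps in $\Lambda_N$ and $$l_N^{(1)}-l_N^{(j)}>\hat c.$$ -/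

import Mathlib

open MeasureTheory ProbabilityTheory Filter
open scoped ENNReal

/-- `M` is a Poisson random measure on `ℝ` with rate `ν` on the probability space `(Ω, P)`: a
measurable map into the measures on `ℝ` whose values on pairwise disjoint Borel sets are
independent and whose value on a bounded Borel set `B` is Poisson distributed with mean
`ν * volume B`. -/
structure IsPoissonRandomMeasure {Ω : Type*} [MeasurableSpace Ω] (P : Measure Ω) (ν : ℝ)
    (M : Ω → Measure ℝ) : Prop where
  measurable : Measurable M
  indep : ∀ (n : ℕ) (B : Fin n → Set ℝ), (∀ i, MeasurableSet (B i)) →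
    (∀ i k, i ≠ k → Disjoint (B i) (B k)) → iIndepFun (fun i ω => M ω (B i)) P
  law : ∀ B : Set ℝ, MeasurableSet B → Bornology.IsBounded B → ∀ m : ℕ,
    P.real {ω | M ω B = (m : ℝ≥0∞)} =
      Real.exp (-(ν * volume.real B)) * (ν * volume.real B) ^ m / (m.factorial : ℝ)

/-- The set of atoms of a measure on `ℝ`. -/
def atomSet (m : Measure ℝ) : Set ℝ := {x | m {x} ≠ 0}

/-- The interval `Λ = (-L/2, L/2)`. -/
def box (L : ℝ) : Set ℝ := Set.Ioo (-L / 2) (L / 2)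

/-- The pairs `(a, b)` of consecutive points of `S` (that is, `a = x̂ⱼ`, `b = x̂ⱼ₊₁` for some `j`
when `S` is labeled increasingly by `ℤ`) for which the interval `(a, b) ∩ Λ` is nonempty. They index
the nonempty intervals into which the points of `S` divide `Λ`, the two outer ones included. -/
def gaps (S : Set ℝ) (L : ℝ) : Set (ℝ × ℝ) :=
  {p | p.1 ∈ S ∧ p.2 ∈ S ∧ p.1 < p.2 ∧ Disjoint (Set.Ioo p.1 p.2) S ∧
    (Set.Ioo p.1 p.2 ∩ box L).Nonempty}

/-- The length of the interval `(a, b) ∩ Λ`, where `p = (a, b)`. -/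
noncomputable def gapLength (L : ℝ) (p : ℝ × ℝ) : ℝ :=
  volume.real (Set.Ioo p.1 p.2 ∩ box L)

/-- The length of the `k`-th longest gap, `k = 1, 2, …`, gaps of equal length being counted
separately: the largest `t` such that at least `k` gaps have length at least `t`. (If there are
fewer than `k` gaps, this is `0`.) -/
noncomputable def gapOrderStat (S : Set ℝ) (L : ℝ) (k : ℕ) : ℝ :=
  sSup {t : ℝ | (k : ℕ∞) ≤ {p ∈ gaps S L | t ≤ gapLength L p}.encard}

/-!
The longest gap among about `ν L` exponential gaps has length `log L / ν` up to a tight random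
shift, while the number of gaps longer than `log L / ν - a` is of order `exp (ν a)`, uniformly in
`L`. So for fixed large `b` and `d > c`, with high probability some gap is longer than `h - b`,
where `h` is `log L / ν` rounded down, while at most `j - 1` gaps are longer than `h - b - d`,
with `j` independent of `L`.

The upper bound on the number of long gaps is a first moment estimate: distinct gaps of length at
least `t + 1` start in distinct unit cells and force distinct windows of length `t` to be empty
(`encard_gaps_le_card_filter`, `IsPoissonRandomMeasure.mul_prob_le_card_empty_windows_le`). The
lower bound on the longest gap is a second moment estimate. A run of empty cells alone is strongly
correlated with its shifts, so one counts the cells that are charged and followed by `m` empty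
cells; these events are pairwise exclusive or independent, and Chebyshev's inequality bounds the
probability that none occurs by the reciprocal of the expected number
(`IsPoissonRandomMeasure.mul_prob_forall_notMem_chargedThenEmpty_le_one`).

The law only prescribes the mass of sets, and the passage to atoms uses that almost surely all
rational intervals have integer mass: then each atom has mass at least one, and a set without
atoms has mass zero (`measure_eq_zero_iff_disjoint_atomSet`).
-/

/-! ### Gaps of locally finite sets -/

/-- A set of reals with finitely many points in each bounded interval and points arbitrarily far
out on both sides: exactly the sets whose points can be labeled increasingly by `ℤ`. -/
structure IsDiscreteUnbounded (S : Set ℝ) : Prop where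
  finite_Icc : ∀ a b, (S ∩ Set.Icc a b).Finite
  exists_gt : ∀ a, ∃ x ∈ S, a < x
  exists_lt : ∀ a, ∃ x ∈ S, x < a

namespace IsDiscreteUnbounded

variable {S : Set ℝ}

theorem exists_first_ge (hS : IsDiscreteUnbounded S) (v : ℝ) :
    ∃ b ∈ S, v ≤ b ∧ ∀ y ∈ S, v ≤ y → b ≤ y := by
  obtain ⟨x, hxS, hx⟩ := hS.exists_gt v
  obtain ⟨b, ⟨hbS, hb⟩, hmin⟩ := Set.exists_min_image _ id (hS.finite_Icc v x)
    ⟨x, hxS, hx.le, le_rfl⟩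
  refine ⟨b, hbS, hb.1, fun y hyS hy => ?_⟩
  rcases le_total y x with h | h
  · exact hmin y ⟨hyS, hy, h⟩
  · exact hb.2.trans h

theorem exists_last_le (hS : IsDiscreteUnbounded S) (u : ℝ) :
    ∃ a ∈ S, a ≤ u ∧ ∀ y ∈ S, y ≤ u → y ≤ a := by
  obtain ⟨x, hxS, hx⟩ := hS.exists_lt u
  obtain ⟨a, ⟨haS, ha⟩, hmax⟩ := Set.exists_max_image _ id (hS.finite_Icc x u)
    ⟨x, hxS, le_rfl, hx.le⟩
  refine ⟨a, haS, ha.2, fun y hyS hy => ?_⟩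
  rcases le_total x y with h | h
  · exact hmax y ⟨hyS, h, hy⟩
  · exact h.trans ha.1

theorem exists_first_gt (hS : IsDiscreteUnbounded S) (x : ℝ) :
    ∃ b ∈ S, x < b ∧ Disjoint (Set.Ioo x b) S := by
  obtain ⟨y, hyS, hy⟩ := hS.exists_gt x
  have hfin : (S ∩ Set.Ioc x y).Finite :=
    (hS.finite_Icc x y).subset (Set.inter_subset_inter_right _ Set.Ioc_subset_Icc_self)
  obtain ⟨b, ⟨hbS, hb⟩, hmin⟩ := Set.exists_min_image _ id hfin ⟨y, hyS, hy, le_rfl⟩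
  refine ⟨b, hbS, hb.1, Set.disjoint_left.2 fun z hz hzS => ?_⟩
  exact absurd (hmin z ⟨hzS, hz.1, hz.2.le.trans hb.2⟩) (not_le.2 hz.2)

end IsDiscreteUnbounded

theorem gapLength_eq (L : ℝ) (p : ℝ × ℝ) :
    gapLength L p = max (min p.2 (L / 2) - max p.1 (-L / 2)) 0 := by
  rw [gapLength, box, Set.Ioo_inter_Ioo, Real.volume_real_Ioo]

theorem gapLength_le {L : ℝ} (hL : 0 ≤ L) (p : ℝ × ℝ) : gapLength L p ≤ L := by
  rw [gapLength_eq]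
  refine max_le ?_ hL
  linarith [min_le_right p.2 (L / 2), le_max_right p.1 (-L / 2)]

theorem exists_gap_of_disjoint {S : Set ℝ} (hS : IsDiscreteUnbounded S) {L u v : ℝ}
    (huv : u < v) (hu : -L / 2 ≤ u) (hv : v ≤ L / 2) (h : Disjoint (Set.Ioo u v) S) :
    ∃ p ∈ gaps S L, v - u ≤ gapLength L p := by
  obtain ⟨a, haS, hau, ha⟩ := hS.exists_last_le u
  obtain ⟨b, hbS, hvb, hb⟩ := hS.exists_first_ge v
  refine ⟨(a, b), ⟨haS, hbS, by dsimp only; linarith, ?_, ?_⟩, ?_⟩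
  · refine Set.disjoint_left.2 fun z hz hzS => ?_
    dsimp only at hz
    rcases le_or_gt z u with h1 | h1
    · exact absurd (ha z hzS h1) (not_le.2 hz.1)
    rcases le_or_gt v z with h2 | h2
    · exact absurd (hb z hzS h2) (not_le.2 hz.2)
    exact Set.disjoint_left.1 h ⟨h1, h2⟩ hzS
  · exact ⟨(u + v) / 2, ⟨by dsimp only; linarith, by dsimp only; linarith⟩,
      ⟨by linarith, by linarith⟩⟩
  · rw [gapLength_eq]
    refine le_max_of_le_left (sub_le_sub ?_ ?_)
    · exact le_min hvb hv
    · exact max_le hau hu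

/-- Each point in the box is the left endpoint of a gap, so there are at least as many gaps as
points in the box. -/
theorem encard_le_encard_gaps {S T : Set ℝ} (hS : IsDiscreteUnbounded S) {L : ℝ}
    (hTS : T ⊆ S) (hT : T ⊆ box L) : T.encard ≤ (gaps S L).encard := by
  have : T ⊆ Prod.fst '' gaps S L := by
    intro x hx
    obtain ⟨b, hbS, hxb, hd⟩ := hS.exists_first_gt x
    refine ⟨(x, b), ⟨hTS hx, hbS, hxb, hd, ?_⟩, rfl⟩
    have hx2 : x < L / 2 := (hT hx).2
    obtain ⟨y, hy1, hy2⟩ := exists_between (lt_min hxb hx2)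
    exact ⟨y, ⟨hy1, hy2.trans_le (min_le_left _ _)⟩,
      ⟨(hT hx).1.trans hy1, hy2.trans_le (min_le_right _ _)⟩⟩
  exact (Set.encard_le_encard this).trans (Set.encard_image_le _ _)

theorem gaps_le_fst_of_lt {S : Set ℝ} {L : ℝ} {p q : ℝ × ℝ} (hp : p ∈ gaps S L)
    (hq : q ∈ gaps S L) (h : p.1 < q.1) : p.2 ≤ q.1 := by
  by_contra! h'
  exact Set.disjoint_left.1 hp.2.2.2.1 ⟨h, h'⟩ hq.1

theorem gaps_eq_of_fst_eq {S : Set ℝ} {L : ℝ} {p q : ℝ × ℝ} (hp : p ∈ gaps S L)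
    (hq : q ∈ gaps S L) (h : p.1 = q.1) : p = q := by
  refine Prod.ext h (le_antisymm ?_ ?_)
  · by_contra! h'
    exact Set.disjoint_left.1 hp.2.2.2.1 ⟨h ▸ hq.2.2.1, h'⟩ hq.2.1
  · by_contra! h'
    exact Set.disjoint_left.1 hq.2.2.2.1 ⟨h ▸ hp.2.2.1, h'⟩ hp.2.1

/-- Distinct gaps of length at least `t + 1` start in distinct cells `[k - L/2, k + 1 - L/2)` of
the unit grid, and if the start lies in this cell, then the `t` following units are free of
points. -/
theorem encard_gaps_le_card_filter {S : Set ℝ} {L : ℝ} (t : ℕ) (F : Finset ℕ)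
    (hF : ∀ k ∈ Finset.range (⌊L⌋₊ + 1),
      Disjoint (Set.Ioo ((k : ℝ) + 1 - L / 2) (k + 1 - L / 2 + t)) S → k ∈ F) :
    {p ∈ gaps S L | ((t + 1 : ℕ) : ℝ) ≤ gapLength L p}.encard ≤ F.card := by
  set A := {p ∈ gaps S L | ((t + 1 : ℕ) : ℝ) ≤ gapLength L p} with hA
  have hlen : ∀ p ∈ A, max p.1 (-L / 2) + (t + 1) ≤ min p.2 (L / 2) := by
    intro p hp
    have h := hp.2
    rw [gapLength_eq] at h
    push_cast at h
    rcases le_max_iff.1 h with h | h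
    · linarith
    · have : (0 : ℝ) ≤ t := t.cast_nonneg
      linarith
  have hnn : ∀ p : ℝ × ℝ, 0 ≤ max p.1 (-L / 2) + L / 2 := by
    intro p
    linarith [le_max_right p.1 (-L / 2)]
  let f : ℝ × ℝ → ℕ := fun p => ⌊max p.1 (-L / 2) + L / 2⌋₊
  have hf1 : ∀ p, (f p : ℝ) ≤ max p.1 (-L / 2) + L / 2 := fun p => Nat.floor_le (hnn p)
  have hf2 : ∀ p, max p.1 (-L / 2) + L / 2 < f p + 1 := fun p => Nat.lt_floor_add_one _
  have hmaps : f '' A ⊆ F := by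
    rintro _ ⟨p, hp, rfl⟩
    have h1 := hf1 p
    have h2 := hf2 p
    have h3 := hlen p hp
    have ht : (0 : ℝ) ≤ t := t.cast_nonneg
    refine hF _ ?_ ?_
    · rw [Finset.mem_range, Nat.lt_succ_iff]
      refine Nat.le_floor ?_
      linarith [min_le_right p.2 (L / 2)]
    · refine hp.1.2.2.2.1.mono_left ?_
      refine Set.Ioo_subset_Ioo ?_ ?_
      · linarith [le_max_left p.1 (-L / 2)]
      · linarith [min_le_left p.2 (L / 2)]
  have hlt : ∀ p ∈ A, ∀ q ∈ A, p.1 < q.1 → f p ≠ f q := by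
    intro p hp q hq h hfe
    have h1 := gaps_le_fst_of_lt hp.1 hq.1 h
    have h2 := hlen p hp
    have h3 := hf1 p
    have h4 := hf2 q
    rw [← hfe] at h4
    have ht : (0 : ℝ) ≤ t := t.cast_nonneg
    linarith [min_le_left p.2 (L / 2), le_max_left q.1 (-L / 2)]
  have hinj : Set.InjOn f A := by
    intro p hp q hq hfe
    rcases lt_trichotomy p.1 q.1 with h | h | h
    · exact absurd hfe (hlt p hp q hq h)
    · exact gaps_eq_of_fst_eq hp.1 hq.1 h
    · exact absurd hfe.symm (hlt q hq p hp h)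
  calc A.encard = (f '' A).encard := hinj.encard_image.symm
    _ ≤ (F : Set ℕ).encard := Set.encard_le_encard hmaps
    _ = F.card := Set.encard_coe_eq_coe_finsetCard F

theorem le_gapOrderStat_one {S : Set ℝ} {L s : ℝ} (hL : 0 ≤ L)
    (h : ∃ p ∈ gaps S L, s ≤ gapLength L p) : s ≤ gapOrderStat S L 1 := by
  refine le_csSup ⟨L, ?_⟩ ?_
  · intro t ht
    simp only [Nat.cast_one, Set.mem_ofPred_eq, Set.one_le_encard_iff_nonempty] at ht
    obtain ⟨p, -, hp⟩ := ht
    exact hp.trans (gapLength_le hL p)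
  · simp only [Nat.cast_one, Set.mem_ofPred_eq, Set.one_le_encard_iff_nonempty]
    obtain ⟨p, hp, hs⟩ := h
    exact ⟨p, hp, hs⟩

theorem gapOrderStat_le {S : Set ℝ} {L s : ℝ} {j : ℕ} (hs : 0 ≤ s)
    (h : {p ∈ gaps S L | s ≤ gapLength L p}.encard < j) : gapOrderStat S L j ≤ s := by
  refine Real.sSup_le (fun t ht => ?_) hs
  by_contra! hst
  refine absurd (le_trans ht (Set.encard_le_encard ?_)) (not_le.2 h)
  exact fun p hp => ⟨hp.1, hst.le.trans hp.2⟩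

/-! ### Measures with integer mass on rational intervals -/

/-- An integer-valued measure vanishes near every point of mass less than one. -/
theorem exists_Ioo_measure_eq_zero {m : Measure ℝ}
    (hm : ∀ a b : ℚ, ∃ n : ℕ, m (Set.Ioo (a : ℝ) b) = n) {x : ℝ} (hx : m {x} < 1) :
    ∃ a b : ℚ, x ∈ Set.Ioo (a : ℝ) b ∧ m (Set.Ioo (a : ℝ) b) = 0 := by
  have : IsLocallyFiniteMeasure m := by
    refine ⟨fun y => ?_⟩
    obtain ⟨a, ha⟩ := exists_rat_lt y
    obtain ⟨b, hb⟩ := exists_rat_gt y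
    obtain ⟨n, hn⟩ := hm a b
    exact ⟨_, Ioo_mem_nhds ha hb, hn ▸ ENNReal.natCast_lt_top n⟩
  obtain ⟨U, hxU, hU, hmU⟩ := Set.exists_isOpen_lt_of_lt {x} 1 hx
  obtain ⟨l, u, hlu, hlU⟩ := mem_nhds_iff_exists_Ioo_subset.1 (hU.mem_nhds (hxU rfl))
  obtain ⟨a, hla, hax⟩ := exists_rat_btwn hlu.1
  obtain ⟨b, hxb, hbu⟩ := exists_rat_btwn hlu.2
  refine ⟨a, b, ⟨hax, hxb⟩, ?_⟩
  have hlt : m (Set.Ioo (a : ℝ) b) < 1 :=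
    (measure_mono ((Set.Ioo_subset_Ioo hla.le hbu.le).trans hlU)).trans_lt hmU
  obtain ⟨n, hn⟩ := hm a b
  rw [hn] at hlt ⊢
  have : n < 1 := by exact_mod_cast hlt
  simp [Nat.lt_one_iff.1 this]

theorem one_le_measure_of_mem_atomSet {m : Measure ℝ}
    (hm : ∀ a b : ℚ, ∃ n : ℕ, m (Set.Ioo (a : ℝ) b) = n) {x : ℝ} (hx : x ∈ atomSet m) :
    1 ≤ m {x} := by
  by_contra! h
  obtain ⟨a, b, hab, h0⟩ := exists_Ioo_measure_eq_zero hm h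
  exact hx (measure_mono_null (Set.singleton_subset_iff.2 hab) h0)

theorem measure_eq_zero_iff_disjoint_atomSet {m : Measure ℝ}
    (hm : ∀ a b : ℚ, ∃ n : ℕ, m (Set.Ioo (a : ℝ) b) = n) (B : Set ℝ) :
    m B = 0 ↔ Disjoint B (atomSet m) := by
  refine ⟨fun h => Set.disjoint_left.2 fun x hx hxa =>
    hxa (measure_mono_null (Set.singleton_subset_iff.2 hx) h), fun h => ?_⟩
  refine measure_null_of_locally_null _ fun x hx => ?_
  have hx0 : m {x} = 0 := by
    by_contra h0
    exact Set.disjoint_left.1 h hx h0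
  obtain ⟨a, b, hab, h0⟩ := exists_Ioo_measure_eq_zero hm (x := x) (by simp [hx0])
  exact ⟨_, mem_nhdsWithin_of_mem_nhds (Ioo_mem_nhds hab.1 hab.2), h0⟩

theorem finite_atomSet_inter_Icc {m : Measure ℝ}
    (hm : ∀ a b : ℚ, ∃ n : ℕ, m (Set.Ioo (a : ℝ) b) = n) (a b : ℝ) :
    (atomSet m ∩ Set.Icc a b).Finite := by
  obtain ⟨a', ha⟩ := exists_rat_lt a
  obtain ⟨b', hb⟩ := exists_rat_gt b
  obtain ⟨n, hn⟩ := hm a' b'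
  by_contra hinf
  obtain ⟨T, hT, hcard⟩ := Set.Infinite.exists_subset_card_eq hinf (n + 1)
  have h1 : ((n + 1 : ℕ) : ℝ≥0∞) ≤ m (Set.Ioo (a' : ℝ) b') := by
    calc ((n + 1 : ℕ) : ℝ≥0∞) = ∑ x ∈ T, (1 : ℝ≥0∞) := by simp [hcard]
      _ ≤ ∑ x ∈ T, m {x} :=
          Finset.sum_le_sum fun x hx => one_le_measure_of_mem_atomSet hm (hT hx).1
      _ = m T := by rw [sum_measure_singleton]
      _ ≤ m (Set.Ioo (a' : ℝ) b') := measure_mono fun x hx => show x ∈ Set.Ioo (a' : ℝ) b' from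
          ⟨ha.trans_le (hT hx).2.1, (hT hx).2.2.trans_lt hb⟩
  rw [hn] at h1
  have : n + 1 ≤ n := by exact_mod_cast h1
  omega

/-! ### Poisson random measures -/

namespace IsPoissonRandomMeasure

variable {Ω : Type*} [MeasurableSpace Ω] {P : Measure Ω} {ν : ℝ}
  {M : Ω → Measure ℝ}

theorem measurable_apply (hM : IsPoissonRandomMeasure P ν M) {B : Set ℝ} (hB : MeasurableSet B) :
    Measurable fun ω => M ω B :=
  (Measure.measurable_coe hB).comp hM.measurable

theorem measurableSet_eq_zero (hM : IsPoissonRandomMeasure P ν M) {B : Set ℝ}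
    (hB : MeasurableSet B) : MeasurableSet {ω | M ω B = 0} :=
  hM.measurable_apply hB (measurableSet_singleton 0)

theorem prob_eq_zero (hM : IsPoissonRandomMeasure P ν M) {B : Set ℝ}
    (hB : MeasurableSet B) (hb : Bornology.IsBounded B) :
    P.real {ω | M ω B = 0} = Real.exp (-(ν * volume.real B)) := by
  simpa using hM.law B hB hb 0

theorem prob_Ico_eq_zero (hM : IsPoissonRandomMeasure P ν M) (a : ℝ) {s : ℝ} (hs : 0 ≤ s) :
    P.real {ω | M ω (Set.Ico a (a + s)) = 0} = Real.exp (-(ν * s)) := by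
  rw [hM.prob_eq_zero measurableSet_Ico (Metric.isBounded_Ico _ _),
    Real.volume_real_Ico_of_le (by linarith), add_sub_cancel_left]

theorem prob_Ioo_eq_zero (hM : IsPoissonRandomMeasure P ν M) (a : ℝ) {s : ℝ} (hs : 0 ≤ s) :
    P.real {ω | M ω (Set.Ioo a (a + s)) = 0} = Real.exp (-(ν * s)) := by
  rw [hM.prob_eq_zero measurableSet_Ioo (Metric.isBounded_Ioo _ _),
    Real.volume_real_Ioo_of_le (by linarith), add_sub_cancel_left]

theorem ae_exists_natCast [IsProbabilityMeasure P]
    (hM : IsPoissonRandomMeasure P ν M) {B : Set ℝ}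
    (hB : MeasurableSet B) (hb : Bornology.IsBounded B) :
    ∀ᵐ ω ∂P, ∃ n : ℕ, M ω B = n := by
  have hmeas : ∀ n : ℕ, MeasurableSet {ω | M ω B = n} := fun n =>
    hM.measurable_apply hB (measurableSet_singleton _)
  have hdisj : Pairwise (Function.onFun Disjoint fun n : ℕ => {ω | M ω B = n}) := by
    intro i k hik
    refine Set.disjoint_left.2 fun ω hi hk => hik ?_
    have : (i : ℝ≥0∞) = k := hi.symm.trans hk
    exact_mod_cast this
  have hsum : HasSum (fun n : ℕ => P.real {ω | M ω B = n}) 1 := by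
    have h := (NormedSpace.expSeries_div_hasSum_exp (ν * volume.real B)).mul_left
      (Real.exp (-(ν * volume.real B)))
    rw [← Real.exp_eq_exp_ℝ, ← Real.exp_add, neg_add_cancel, Real.exp_zero] at h
    refine h.congr_fun fun n => ?_
    rw [hM.law B hB hb n, mul_div_assoc]
  have hU : P (⋃ n : ℕ, {ω | M ω B = n}) = 1 := by
    rw [measure_iUnion hdisj hmeas]
    have h2 : ∀ n : ℕ, P {ω | M ω B = n} = ENNReal.ofReal (P.real {ω | M ω B = n}) :=
      fun n => (ofReal_measureReal).symm
    simp_rw [h2]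
    rw [← ENNReal.ofReal_tsum_of_nonneg (fun n => measureReal_nonneg) hsum.summable,
      hsum.tsum_eq, ENNReal.ofReal_one]
  have h3 := (prob_compl_eq_zero_iff (MeasurableSet.iUnion hmeas)).2 hU
  filter_upwards [compl_mem_ae_iff.2 h3] with ω hω
  simpa using hω

theorem ae_ne_zero_of_forall_Ioo_subset [IsProbabilityMeasure P]
    (hM : IsPoissonRandomMeasure P ν M) (hν : 0 < ν) {B : Set ℝ}
    (hB : ∀ n : ℕ, ∃ a : ℝ, Set.Ioo a (a + n) ⊆ B) : ∀ᵐ ω ∂P, M ω B ≠ 0 := by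
  have hle : ∀ n : ℕ, P.real {ω | M ω B = 0} ≤ Real.exp (-(ν * n)) := by
    intro n
    obtain ⟨a, ha⟩ := hB n
    rw [← hM.prob_Ioo_eq_zero a n.cast_nonneg]
    exact measureReal_mono fun ω hω => measure_mono_null ha hω
  have hlim : Tendsto (fun n : ℕ => Real.exp (-(ν * n))) atTop (nhds 0) :=
    Real.tendsto_exp_neg_atTop_nhds_zero.comp
      (tendsto_natCast_atTop_atTop.const_mul_atTop hν)
  have h0 : P.real {ω | M ω B = 0} = 0 :=
    le_antisymm (ge_of_tendsto' hlim hle) measureReal_nonneg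
  rw [measureReal_eq_zero_iff] at h0
  rw [ae_iff]
  simpa using h0

theorem ae_forall_rat [IsProbabilityMeasure P]
    (hM : IsPoissonRandomMeasure P ν M) :
    ∀ᵐ ω ∂P, ∀ a b : ℚ, ∃ n : ℕ, M ω (Set.Ioo (a : ℝ) b) = n :=
  ae_all_iff.2 fun _ => ae_all_iff.2 fun _ =>
    hM.ae_exists_natCast measurableSet_Ioo (Metric.isBounded_Ioo _ _)

theorem ae_isDiscreteUnbounded [IsProbabilityMeasure P]
    (hM : IsPoissonRandomMeasure P ν M) (hν : 0 < ν) :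
    ∀ᵐ ω ∂P, IsDiscreteUnbounded (atomSet (M ω)) := by
  have h1 : ∀ᵐ ω ∂P, ∀ a : ℕ, M ω (Set.Ioi (a : ℝ)) ≠ 0 := ae_all_iff.2 fun a =>
    hM.ae_ne_zero_of_forall_Ioo_subset hν fun n => ⟨a, fun x hx => hx.1⟩
  have h2 : ∀ᵐ ω ∂P, ∀ a : ℕ, M ω (Set.Iio (-(a : ℝ))) ≠ 0 := ae_all_iff.2 fun a =>
    hM.ae_ne_zero_of_forall_Ioo_subset hν fun n => ⟨-a - n, fun x hx => by
      have := hx.2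
      rw [Set.mem_Iio]
      linarith⟩
  filter_upwards [hM.ae_forall_rat, h1, h2] with ω h h1 h2
  refine ⟨finite_atomSet_inter_Icc h, fun a => ?_, fun a => ?_⟩
  · obtain ⟨n, hn⟩ := exists_nat_gt a
    have := h1 n
    rw [Ne, measure_eq_zero_iff_disjoint_atomSet h, Set.not_disjoint_iff] at this
    obtain ⟨x, hx, hxS⟩ := this
    exact ⟨x, hxS, hn.trans hx⟩
  · obtain ⟨n, hn⟩ := exists_nat_gt (-a)
    have := h2 n
    rw [Ne, measure_eq_zero_iff_disjoint_atomSet h, Set.not_disjoint_iff] at this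
    obtain ⟨x, hx, hxS⟩ := this
    refine ⟨x, hxS, ?_⟩
    rw [Set.mem_Iio] at hx
    linarith

end IsPoissonRandomMeasure

/-! ### First and second moments of the number of events that occur -/

section Moments

variable {Ω ι : Type*} [MeasurableSpace Ω] {P : Measure Ω} [IsProbabilityMeasure P]

open scoped Classical in
theorem natCast_mul_prob_le_card_filter_le (F : Finset ι) {A : ι → Set Ω}
    (hA : ∀ i, MeasurableSet (A i)) (j : ℕ) :
    j * P.real {ω | j ≤ (F.filter fun i => ω ∈ A i).card} ≤ ∑ i ∈ F, P.real (A i) := by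
  have hcard : ∀ ω, ((F.filter fun i => ω ∈ A i).card : ℝ) =
      ∑ i ∈ F, (A i).indicator (fun _ => (1 : ℝ)) ω := by
    intro ω
    simp [Set.indicator_apply]
  have hint : ∀ i ∈ F, Integrable ((A i).indicator fun _ => (1 : ℝ)) P := fun i _ =>
    (integrable_const _).indicator (hA i)
  have h := mul_meas_ge_le_integral_of_nonneg (μ := P)
    (f := fun ω => ∑ i ∈ F, (A i).indicator (fun _ => (1 : ℝ)) ω)
    (Eventually.of_forall fun ω => Finset.sum_nonneg fun i _ =>
      Set.indicator_nonneg (fun _ _ => zero_le_one) _)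
    (integrable_finsetSum F hint) j
  rw [integral_finsetSum F hint] at h
  simp only [integral_indicator_const _ (hA _), smul_eq_mul, mul_one] at h
  simpa only [← hcard, Nat.cast_le] using h

/-- Chebyshev's inequality for the number of events that occur. -/
theorem card_mul_mul_prob_forall_notMem_le_one (F : Finset ι) {A : ι → Set Ω}
    (hA : ∀ i, MeasurableSet (A i)) {q : ℝ} (hq : ∀ i ∈ F, P.real (A i) = q)
    (hqq : ∀ i ∈ F, ∀ k ∈ F, i ≠ k → P.real (A i ∩ A k) ≤ q ^ 2) :
    F.card * q * P.real {ω | ∀ i ∈ F, ω ∉ A i} ≤ 1 := by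
  classical
  rcases F.eq_empty_or_nonempty with rfl | ⟨i₀, hi₀⟩
  · simp
  have hq0 : 0 ≤ q := hq i₀ hi₀ ▸ measureReal_nonneg
  let Y : ι → Ω → ℝ := fun i ω => (A i).indicator (fun _ => (1 : ℝ)) ω - q
  have hYY : ∀ i k, (fun ω => Y i ω * Y k ω) = fun ω =>
      (A i ∩ A k).indicator (fun _ => (1 : ℝ)) ω - q * (A i).indicator (fun _ => (1 : ℝ)) ω
        - q * (A k).indicator (fun _ => (1 : ℝ)) ω + q ^ 2 := by
    intro i k
    funext ω
    by_cases h1 : ω ∈ A i <;> by_cases h2 : ω ∈ A k <;> simp [Y, h1, h2] <;> ring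
  have hint : ∀ B : Set Ω, MeasurableSet B → Integrable (B.indicator fun _ => (1 : ℝ)) P :=
    fun B hB => (integrable_const _).indicator hB
  have hYint : ∀ i k, Integrable (fun ω => Y i ω * Y k ω) P := by
    intro i k
    rw [hYY]
    exact (((hint _ ((hA i).inter (hA k))).sub ((hint _ (hA i)).const_mul q)).sub
      ((hint _ (hA k)).const_mul q)).add (integrable_const _)
  have hYval : ∀ i ∈ F, ∀ k ∈ F, ∫ ω, Y i ω * Y k ω ∂P = P.real (A i ∩ A k) - q ^ 2 := by
    intro i hi k hk
    have e1 := hint _ ((hA i).inter (hA k))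
    have e2 : Integrable (fun ω => q * (A i).indicator (fun _ => (1 : ℝ)) ω) P :=
      (hint _ (hA i)).const_mul q
    have e3 : Integrable (fun ω => q * (A k).indicator (fun _ => (1 : ℝ)) ω) P :=
      (hint _ (hA k)).const_mul q
    have e4 : Integrable (fun ω => (A i ∩ A k).indicator (fun _ => (1 : ℝ)) ω -
      q * (A i).indicator (fun _ => (1 : ℝ)) ω) P := e1.sub e2
    have e5 : Integrable (fun ω => (A i ∩ A k).indicator (fun _ => (1 : ℝ)) ω -
      q * (A i).indicator (fun _ => (1 : ℝ)) ω - q * (A k).indicator (fun _ => (1 : ℝ)) ω) P :=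
      e4.sub e3
    rw [hYY, integral_add e5 (integrable_const _), integral_sub e4 e3, integral_sub e1 e2,
      integral_const_mul, integral_const_mul,
      integral_indicator_const _ ((hA i).inter (hA k)), integral_indicator_const _ (hA i),
      integral_indicator_const _ (hA k), hq i hi, hq k hk]
    simp
    ring
  have hsq : ∀ ω, (∑ i ∈ F, Y i ω) ^ 2 = ∑ i ∈ F, ∑ k ∈ F, Y i ω * Y k ω := by
    intro ω
    rw [sq, Finset.sum_mul_sum]
  have hvar : ∫ ω, (∑ i ∈ F, Y i ω) ^ 2 ∂P ≤ F.card * q := by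
    simp_rw [hsq]
    rw [integral_finsetSum F fun i _ => integrable_finsetSum F fun k _ => hYint i k]
    rw [← nsmul_eq_mul]
    refine Finset.sum_le_card_nsmul _ _ _ fun i hi => ?_
    rw [integral_finsetSum F fun k _ => hYint i k]
    calc ∑ k ∈ F, ∫ ω, Y i ω * Y k ω ∂P ≤ ∑ k ∈ F, if i = k then q else 0 := by
          refine Finset.sum_le_sum fun k hk => ?_
          rw [hYval i hi k hk]
          split_ifs with h
          · subst h
            rw [Set.inter_self, hq i hi]
            linarith [sq_nonneg q]
          · linarith [hqq i hi k hk h]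
      _ = q := by simp [hi]
  have hsqint : Integrable (fun ω => (∑ i ∈ F, Y i ω) ^ 2) P := by
    simp_rw [hsq]
    exact integrable_finsetSum F fun i _ => integrable_finsetSum F fun k _ => hYint i k
  have hmarkov := mul_meas_ge_le_integral_of_nonneg
    (Eventually.of_forall fun ω => sq_nonneg (∑ i ∈ F, Y i ω)) hsqint ((F.card * q) ^ 2)
  have hsub : P.real {ω | ∀ i ∈ F, ω ∉ A i} ≤
      P.real {ω | (F.card * q) ^ 2 ≤ (∑ i ∈ F, Y i ω) ^ 2} := by
    refine measureReal_mono fun ω hω => ?_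
    have : ∑ i ∈ F, Y i ω = -(F.card * q) := by
      rw [Finset.sum_congr rfl fun i hi => (by simp [Y, hω i hi] : Y i ω = -q)]
      simp
    simp [this]
  rcases (mul_nonneg F.card.cast_nonneg hq0 : (0 : ℝ) ≤ F.card * q).eq_or_lt with h0 | h0
  · rw [← h0, zero_mul]
    exact zero_le_one
  · refine le_of_mul_le_mul_left ?_ h0
    calc F.card * q * (F.card * q * P.real {ω | ∀ i ∈ F, ω ∉ A i})
        = (F.card * q) ^ 2 * P.real {ω | ∀ i ∈ F, ω ∉ A i} := by ring
      _ ≤ (F.card * q) ^ 2 * P.real {ω | (F.card * q) ^ 2 ≤ (∑ i ∈ F, Y i ω) ^ 2} := by gcongr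
      _ ≤ F.card * q * 1 := by rw [mul_one]; exact hmarkov.trans hvar

end Moments

/-! ### Isolated empty windows of a Poisson random measure -/

namespace IsPoissonRandomMeasure

variable {Ω : Type*} [MeasurableSpace Ω] {P : Measure Ω} {ν : ℝ} {M : Ω → Measure ℝ}

theorem prob_forall_mem (hM : IsPoissonRandomMeasure P ν M) {n : ℕ} {B : Fin n → Set ℝ}
    (hB : ∀ i, MeasurableSet (B i)) (hdisj : ∀ i k, i ≠ k → Disjoint (B i) (B k))
    {T : Fin n → Set ℝ≥0∞} (hT : ∀ i, MeasurableSet (T i)) :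
    P.real {ω | ∀ i, M ω (B i) ∈ T i} = ∏ i, P.real {ω | M ω (B i) ∈ T i} := by
  have h := (hM.indep n B hB hdisj).measure_inter_preimage_eq_mul Finset.univ
    (sets := T) fun i _ => hT i
  have hset : {ω | ∀ i, M ω (B i) ∈ T i} =
      ⋂ i ∈ Finset.univ, (fun ω => M ω (B i)) ⁻¹' T i := by
    ext ω
    simp
  rw [hset, measureReal_def, h, ENNReal.toReal_prod]
  rfl

end IsPoissonRandomMeasure

/-- The event that `M` charges the unit cell `[a, a + 1)` but not the window `[a + 1, a + 1 + s)`
following it. -/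
def chargedThenEmpty {Ω : Type*} (M : Ω → Measure ℝ) (s a : ℝ) : Set Ω :=
  {ω | M ω (Set.Ico a (a + 1)) ≠ 0 ∧ M ω (Set.Ico (a + 1) (a + 1 + s)) = 0}

namespace IsPoissonRandomMeasure

variable {Ω : Type*} [MeasurableSpace Ω] {P : Measure Ω} {ν : ℝ} {M : Ω → Measure ℝ}

theorem measurableSet_chargedThenEmpty (hM : IsPoissonRandomMeasure P ν M) (s a : ℝ) :
    MeasurableSet (chargedThenEmpty M s a) :=
  (hM.measurableSet_eq_zero measurableSet_Ico).compl.inter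
    (hM.measurableSet_eq_zero measurableSet_Ico)

theorem prob_Ico_ne_zero [IsProbabilityMeasure P] (hM : IsPoissonRandomMeasure P ν M) (a : ℝ) :
    P.real {ω | M ω (Set.Ico a (a + 1)) ≠ 0} = 1 - Real.exp (-ν) := by
  have h := probReal_compl_eq_one_sub (μ := P)
    (hM.measurableSet_eq_zero (B := Set.Ico a (a + 1)) measurableSet_Ico)
  rw [hM.prob_Ico_eq_zero a zero_le_one, mul_one] at h
  exact h

theorem prob_chargedThenEmpty [IsProbabilityMeasure P] (hM : IsPoissonRandomMeasure P ν M)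
    {s : ℝ} (hs : 0 ≤ s) (a : ℝ) :
    P.real (chargedThenEmpty M s a) = (1 - Real.exp (-ν)) * Real.exp (-(ν * s)) := by
  have h := hM.prob_forall_mem (n := 2)
    (B := ![Set.Ico a (a + 1), Set.Ico (a + 1) (a + 1 + s)]) (T := ![{0}ᶜ, {0}])
    (by simp [Fin.forall_fin_two])
    (by
      simp only [Fin.forall_fin_two]
      simp [Set.disjoint_left]
      grind)
    (by simp [Fin.forall_fin_two])
  simp only [Fin.forall_fin_two, Fin.prod_univ_two] at h
  rw [← hM.prob_Ico_ne_zero a, ← hM.prob_Ico_eq_zero (a + 1) hs]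
  exact h

theorem prob_chargedThenEmpty_inter_le [IsProbabilityMeasure P]
    (hM : IsPoissonRandomMeasure P ν M) {s : ℝ} (hs : 0 ≤ s) {a b : ℝ}
    (hab : a + 1 ≤ b) (h : b + 1 ≤ a + 1 + s ∨ a + 1 + s ≤ b) :
    P.real (chargedThenEmpty M s a ∩ chargedThenEmpty M s b) ≤
      ((1 - Real.exp (-ν)) * Real.exp (-(ν * s))) ^ 2 := by
  rcases h with h | h
  · -- the window after `a` contains the cell of `b`, so the two events exclude each other
    have : chargedThenEmpty M s a ∩ chargedThenEmpty M s b = ∅ := by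
      refine Set.eq_empty_iff_forall_notMem.2 fun ω hω => hω.2.1 ?_
      exact measure_mono_null (Set.Ico_subset_Ico hab h) hω.1.2
    rw [this, measureReal_empty]
    positivity
  · -- the events depend on disjoint sets, so they are independent
    have hi := hM.prob_forall_mem (n := 4)
      (B := ![Set.Ico a (a + 1), Set.Ico (a + 1) (a + 1 + s),
        Set.Ico b (b + 1), Set.Ico (b + 1) (b + 1 + s)]) (T := ![{0}ᶜ, {0}, {0}ᶜ, {0}])
      (by simp [Fin.forall_fin_succ])
      (by
        have h1 : Disjoint (Set.Ico a (a + 1)) (Set.Ico (a + 1) (a + 1 + s)) := by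
          rw [Set.disjoint_left]; grind
        have h2 : Disjoint (Set.Ico a (a + 1)) (Set.Ico b (b + 1)) := by
          rw [Set.disjoint_left]; grind
        have h3 : Disjoint (Set.Ico a (a + 1)) (Set.Ico (b + 1) (b + 1 + s)) := by
          rw [Set.disjoint_left]; grind
        have h4 : Disjoint (Set.Ico (a + 1) (a + 1 + s)) (Set.Ico b (b + 1)) := by
          rw [Set.disjoint_left]; grind
        have h5 : Disjoint (Set.Ico (a + 1) (a + 1 + s)) (Set.Ico (b + 1) (b + 1 + s)) := by
          rw [Set.disjoint_left]; grind
        have h6 : Disjoint (Set.Ico b (b + 1)) (Set.Ico (b + 1) (b + 1 + s)) := by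
          rw [Set.disjoint_left]; grind
        intro i k hik
        fin_cases i <;> fin_cases k <;> first
          | exact absurd rfl hik
          | assumption
          | (refine Disjoint.symm ?_; assumption))
      (by simp [Fin.forall_fin_succ])
    have hset : chargedThenEmpty M s a ∩ chargedThenEmpty M s b =
        {ω | ∀ i, M ω (![Set.Ico a (a + 1), Set.Ico (a + 1) (a + 1 + s),
          Set.Ico b (b + 1), Set.Ico (b + 1) (b + 1 + s)] i) ∈
            (![{0}ᶜ, {0}, {0}ᶜ, {0}] : Fin 4 → Set ℝ≥0∞) i} := by
      ext ω
      simp [chargedThenEmpty, Fin.forall_fin_succ, and_assoc]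
    rw [hset, hi, Fin.prod_univ_four]
    refine le_of_eq ?_
    rw [sq, mul_assoc]
    nth_rw 1 [← hM.prob_Ico_ne_zero a]
    nth_rw 1 [← hM.prob_Ico_eq_zero (a + 1) hs]
    rw [← hM.prob_Ico_ne_zero b, ← hM.prob_Ico_eq_zero (b + 1) hs, ← mul_assoc, ← mul_assoc]
    rfl

/-- The charged cells with `m` empty cells after them are pairwise exclusive or independent, so
one of them occurs with high probability once the expected number is large. -/
theorem mul_prob_forall_notMem_chargedThenEmpty_le_one [IsProbabilityMeasure P]
    (hM : IsPoissonRandomMeasure P ν M) (m n : ℕ) (x : ℝ) :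
    n * ((1 - Real.exp (-ν)) * Real.exp (-(ν * m))) *
      P.real {ω | ∀ k ∈ Finset.range n, ω ∉ chargedThenEmpty M m (x + k)} ≤ 1 := by
  have key : ∀ i k : ℕ, i < k →
      P.real (chargedThenEmpty M m (x + i) ∩ chargedThenEmpty M m (x + k)) ≤
        ((1 - Real.exp (-ν)) * Real.exp (-(ν * m))) ^ 2 := by
    intro i k hik
    refine hM.prob_chargedThenEmpty_inter_le m.cast_nonneg ?_ ?_
    · have : (i : ℝ) + 1 ≤ k := by exact_mod_cast hik
      linarith
    · rcases lt_or_ge k (i + 1 + m) with h | h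
      · left
        have : (k : ℝ) + 1 ≤ i + 1 + m := by exact_mod_cast h
        linarith
      · right
        have : (i : ℝ) + 1 + m ≤ k := by exact_mod_cast h
        linarith
  have h := card_mul_mul_prob_forall_notMem_le_one (P := P) (Finset.range n)
    (A := fun k : ℕ => chargedThenEmpty M m (x + k))
    (fun k => hM.measurableSet_chargedThenEmpty _ _)
    (fun k _ => hM.prob_chargedThenEmpty m.cast_nonneg _)
    (fun i _ k _ hik => by
      rcases hik.lt_or_gt with h | h
      · exact key i k h
      · rw [Set.inter_comm]
        exact key k i h)
  rwa [Finset.card_range] at h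

open scoped Classical in
theorem mul_prob_le_card_empty_windows_le [IsProbabilityMeasure P]
    (hM : IsPoissonRandomMeasure P ν M) (t n j : ℕ) (x : ℝ) :
    j * P.real {ω | j ≤ ((Finset.range n).filter fun k : ℕ =>
      M ω (Set.Ioo ((k : ℝ) + 1 - x) (k + 1 - x + t)) = 0).card} ≤ n * Real.exp (-(ν * t)) := by
  have h := natCast_mul_prob_le_card_filter_le (P := P) (Finset.range n)
    (A := fun k : ℕ => {ω | M ω (Set.Ioo ((k : ℝ) + 1 - x) (k + 1 - x + t)) = 0})
    (fun k => hM.measurableSet_eq_zero measurableSet_Ioo) j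
  refine (le_of_eq ?_).trans (h.trans (le_of_eq ?_))
  · congr!
  · simp [hM.prob_Ioo_eq_zero _ t.cast_nonneg]

theorem prob_exists_Ico_eq_zero_le [IsProbabilityMeasure P]
    (hM : IsPoissonRandomMeasure P ν M) (r j : ℕ) :
    P.real {ω | ∃ i ∈ Finset.range j, M ω (Set.Ico ((i : ℝ) * r) (i * r + r)) = 0} ≤
      j * Real.exp (-(ν * r)) := by
  have hset : {ω | ∃ i ∈ Finset.range j, M ω (Set.Ico ((i : ℝ) * r) (i * r + r)) = 0} =
      ⋃ i ∈ Finset.range j, {ω | M ω (Set.Ico ((i : ℝ) * r) (i * r + r)) = 0} := by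
    ext ω
    simp
  rw [hset]
  refine (measureReal_biUnion_finset_le _ _).trans (le_of_eq ?_)
  simp [hM.prob_Ico_eq_zero _ r.cast_nonneg]

end IsPoissonRandomMeasure

/-! ### Separation of the order statistics -/

open scoped Classical in
/-- The realizations for which the order statistics are separated: some cell is followed by an
empty window of length `t + d + 1`, fewer than `j` windows of length `t` are empty, and `j`
disjoint fixed intervals are charged. -/
theorem le_encard_gaps_and_lt_gapOrderStat_sub {m : Measure ℝ}
    (hm : ∀ a b : ℚ, ∃ n : ℕ, m (Set.Ioo (a : ℝ) b) = n)
    (hS : IsDiscreteUnbounded (atomSet m)) {L : ℝ} {t d j r : ℕ} {c : ℝ} (hcd : c < d)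
    (hjr : 2 * (j * r : ℝ) ≤ L) (hL : 0 < L)
    {k : ℕ} (hk : (k : ℝ) + 1 + (t + d + 1 : ℕ) ≤ L)
    (hempty : m (Set.Ico (-L / 2 + k + 1) (-L / 2 + k + 1 + (t + d + 1 : ℕ))) = 0)
    (hcard : ((Finset.range (⌊L⌋₊ + 1)).filter fun k : ℕ =>
      m (Set.Ioo ((k : ℝ) + 1 - L / 2) (k + 1 - L / 2 + t)) = 0).card < j)
    (hcharged : ∀ i ∈ Finset.range j, m (Set.Ico ((i : ℝ) * r) (i * r + r)) ≠ 0) :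
    (j : ℕ∞) ≤ (gaps (atomSet m) L).encard ∧
      c < gapOrderStat (atomSet m) L 1 - gapOrderStat (atomSet m) L j := by
  constructor
  · have hex : ∀ i : Fin j, ∃ x ∈ Set.Ico ((i : ℝ) * r) (i * r + r), x ∈ atomSet m := by
      intro i
      have := hcharged i (Finset.mem_range.2 i.2)
      rwa [Ne, measure_eq_zero_iff_disjoint_atomSet hm, Set.not_disjoint_iff] at this
    choose x hx hxS using hex
    have hlt : ∀ i k : Fin j, i < k → x i < x k := by
      intro i k hik
      have h1 : ((i : ℕ) : ℝ) + 1 ≤ (k : ℕ) := by exact_mod_cast hik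
      have h2 : (((i : ℕ) : ℝ) + 1) * r ≤ (k : ℕ) * r := by gcongr
      linarith [(hx i).2, (hx k).1]
    have hinj : Function.Injective x := (show StrictMono x from fun i k h => hlt i k h).injective
    have hcardT : (Set.range x).encard = j := by
      rw [← Set.image_univ, hinj.injOn.encard_image, Set.encard_univ]
      simp
    rw [← hcardT]
    refine encard_le_encard_gaps hS (Set.range_subset_iff.2 hxS) (Set.range_subset_iff.2 ?_)
    intro i
    have h1 : ((i : ℕ) : ℝ) + 1 ≤ j := by exact_mod_cast i.2
    have h2 : (((i : ℕ) : ℝ) + 1) * r ≤ j * r := by gcongr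
    have h3 : 0 ≤ ((i : ℕ) : ℝ) * r := by positivity
    have h4 := hx i
    exact ⟨by linarith [h4.1], by linarith [h4.2]⟩
  · have hlong : ((t + d + 1 : ℕ) : ℝ) ≤ gapOrderStat (atomSet m) L 1 := by
      refine le_gapOrderStat_one hL.le ?_
      have hpos : (0 : ℝ) < (t + d + 1 : ℕ) := by positivity
      obtain ⟨p, hp, hlen⟩ := exists_gap_of_disjoint hS (L := L)
        (u := -L / 2 + k + 1) (v := -L / 2 + k + 1 + (t + d + 1 : ℕ)) (by linarith)
        (by linarith [(k.cast_nonneg : (0 : ℝ) ≤ k)]) (by linarith)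
        (((measure_eq_zero_iff_disjoint_atomSet hm _).1 hempty).mono_left
          Set.Ioo_subset_Ico_self)
      exact ⟨p, hp, by linarith⟩
    have hshort : gapOrderStat (atomSet m) L j ≤ ((t + 1 : ℕ) : ℝ) := by
      refine gapOrderStat_le (Nat.cast_nonneg _) ?_
      refine (encard_gaps_le_card_filter t _ fun k hk hd => Finset.mem_filter.2 ⟨hk, ?_⟩).trans_lt
        (Nat.cast_lt.2 hcard)
      exact (measure_eq_zero_iff_disjoint_atomSet hm _).2 hd
    push_cast at hlong hshort
    linarith

/-- For large boxes a length `h` exists at which the probability `exp (-ν h)` of an empty window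
is the reciprocal of the box length, up to a constant factor; moreover `h` is large, yet small
compared with the box. -/
theorem eventually_exists_nat_exp_le {ν : ℝ} (hν : 0 < ν) (s : ℕ) :
    ∀ᶠ L : ℝ in atTop, ∃ h : ℕ, s ≤ h ∧ 2 * (h + 2 : ℝ) ≤ L ∧
      1 ≤ L * Real.exp (-(ν * h)) ∧ L * Real.exp (-(ν * h)) ≤ Real.exp ν := by
  have hlog : ∀ᶠ L : ℝ in atTop, Real.log L ≤ ν / 4 * L := by
    filter_upwards [Real.isLittleO_log_id_atTop.bound (show 0 < ν / 4 by positivity),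
      eventually_ge_atTop 1] with L hL h1
    rw [Real.norm_of_nonneg (Real.log_nonneg h1), id, Real.norm_of_nonneg (by linarith)] at hL
    exact hL
  filter_upwards [hlog, eventually_ge_atTop 8,
    Real.tendsto_log_atTop.eventually_ge_atTop (ν * s)] with L h1 h2 h3
  have hL0 : 0 < L := by linarith
  have hln : 0 ≤ Real.log L / ν := div_nonneg (Real.log_nonneg (by linarith)) hν.le
  have hfl : (⌊Real.log L / ν⌋₊ : ℝ) ≤ Real.log L / ν := Nat.floor_le hln
  have hfl2 : Real.log L / ν < ⌊Real.log L / ν⌋₊ + 1 := Nat.lt_floor_add_one _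
  have hexp : L * Real.exp (-(ν * ⌊Real.log L / ν⌋₊)) =
      Real.exp (Real.log L - ν * ⌊Real.log L / ν⌋₊) := by
    rw [sub_eq_add_neg, Real.exp_add, Real.exp_log hL0]
  refine ⟨⌊Real.log L / ν⌋₊, Nat.le_floor ?_, ?_, ?_, ?_⟩
  · rw [le_div_iff₀ hν]
    linarith
  · have : Real.log L / ν ≤ L / 4 := by
      rw [div_le_iff₀ hν]
      linarith
    linarith
  · rw [hexp, Real.one_le_exp_iff]
    rw [le_div_iff₀ hν] at hfl
    linarith
  · rw [hexp, Real.exp_le_exp]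
    rw [div_lt_iff₀ hν] at hfl2
    linarith

theorem proposition3p7 {Ω : Type*} [MeasurableSpace Ω] (P : Measure Ω) [IsProbabilityMeasure P]
    (ν : ℝ) (hν : 0 < ν) (M : Ω → Measure ℝ) (hM : IsPoissonRandomMeasure P ν M)
    (ρ : ℝ) (hρ : 0 < ρ) (L : ℕ → ℝ) (hL : ∀ N : ℕ, 1 ≤ N → (N : ℝ) / L N = ρ)
    (ε : ℝ) (hε : 0 < ε) (c : ℝ) (hc : 0 < c) :
    ∃ j : ℕ, 1 ≤ j ∧ ∀ᶠ N : ℕ in atTop,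
      1 - ε ≤ P.real {ω | (j : ℕ∞) ≤ (gaps (atomSet (M ω)) (L N)).encard ∧
        c < gapOrderStat (atomSet (M ω)) (L N) 1 - gapOrderStat (atomSet (M ω)) (L N) j} := by
  classical
  have hLtop : Tendsto L atTop atTop := by
    have h1 : Tendsto (fun N : ℕ => (N : ℝ) / ρ) atTop atTop :=
      tendsto_natCast_atTop_atTop.atTop_div_const hρ
    refine h1.congr' ?_
    filter_upwards [eventually_ge_atTop 1] with N hN
    have h0 : L N ≠ 0 := by
      intro h0
      have := hL N hN
      rw [h0, div_zero] at this
      exact hρ.ne this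
    rw [← hL N hN]
    have : (N : ℝ) ≠ 0 := by positivity
    field_simp
  have hqpos : 0 < 1 - Real.exp (-ν) := by
    rw [sub_pos, Real.exp_lt_one_iff]
    linarith
  have hexp_top : Tendsto (fun n : ℕ => Real.exp (ν * n)) atTop atTop :=
    Real.tendsto_exp_atTop.comp (tendsto_natCast_atTop_atTop.const_mul_atTop hν)
  obtain ⟨d, hd⟩ := exists_nat_gt c
  -- `b` makes the expected number of windows longer than `h - b` large
  obtain ⟨b, hb⟩ := (hexp_top.eventually_ge_atTop (6 / (ε * (1 - Real.exp (-ν))))).exists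
  -- `j` exceeds by far the expected number of windows longer than `h - b - d`
  obtain ⟨j, hj⟩ := exists_nat_gt (6 * Real.exp (ν * (b + d + 2)) / ε)
  have hj0 : (0 : ℝ) < j := lt_trans (by positivity) hj
  -- `j` disjoint intervals of length `r` are likely to be charged simultaneously
  obtain ⟨r, hr⟩ := (hexp_top.eventually_ge_atTop (3 * j / ε)).exists
  refine ⟨j, by exact_mod_cast hj0, ?_⟩
  filter_upwards [hLtop.eventually (eventually_exists_nat_exp_le hν (b + d + 1)),
    hLtop.eventually_ge_atTop (2 * (j * r)), hLtop.eventually_ge_atTop 1]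
    with N ⟨h, hh, hhL, hlow, hup⟩ hjr hL1
  obtain ⟨t, rfl⟩ := Nat.exists_eq_add_of_le hh
  set l := L N with hl
  have hfloor : (⌊l⌋₊ : ℝ) ≤ l := Nat.floor_le (by linarith)
  have hfloor' : l < ⌊l⌋₊ + 1 := Nat.lt_floor_add_one _
  obtain ⟨n, hn⟩ : ∃ n : ℕ, ⌊l⌋₊ = n + (t + d + 2) := by
    refine ⟨⌊l⌋₊ - (t + d + 2), (Nat.sub_add_cancel ?_).symm⟩
    refine Nat.le_floor ?_
    push_cast at hhL ⊢
    have : (0 : ℝ) ≤ b := b.cast_nonneg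
    have : (0 : ℝ) ≤ t := t.cast_nonneg
    have : (0 : ℝ) ≤ d := d.cast_nonneg
    linarith
  have hn' : (⌊l⌋₊ : ℝ) = n + (t + d + 2) := by exact_mod_cast hn
  have hnl : l / 2 ≤ n := by
    push_cast at hhL
    have : (0 : ℝ) ≤ b := b.cast_nonneg
    linarith
  -- the exceptional events: no gap longer than `h - b`; too many gaps longer than `h - b - d`;
  -- possibly fewer than `j` gaps; an atypical realization
  set A := {ω | ∀ k ∈ Finset.range n, ω ∉ chargedThenEmpty M (t + d + 1 : ℕ) (-l / 2 + k)}
  set B := {ω | j ≤ ((Finset.range (⌊l⌋₊ + 1)).filter fun k : ℕ =>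
    M ω (Set.Ioo ((k : ℝ) + 1 - l / 2) (k + 1 - l / 2 + t)) = 0).card}
  set C := {ω | ∃ i ∈ Finset.range j, M ω (Set.Ico ((i : ℝ) * r) (i * r + r)) = 0}
  set E := {ω | ¬ ((∀ a b : ℚ, ∃ n : ℕ, M ω (Set.Ioo (a : ℝ) b) = n) ∧
    IsDiscreteUnbounded (atomSet (M ω)))}
  set G := {ω | (j : ℕ∞) ≤ (gaps (atomSet (M ω)) l).encard ∧
    c < gapOrderStat (atomSet (M ω)) l 1 - gapOrderStat (atomSet (M ω)) l j}
  have hA : P.real A ≤ ε / 3 := by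
    have h1 := hM.mul_prob_forall_notMem_chargedThenEmpty_le_one (t + d + 1) n (-l / 2)
    have h2 : 3 / ε ≤ n * ((1 - Real.exp (-ν)) * Real.exp (-(ν * (t + d + 1 : ℕ)))) := by
      have he : Real.exp (-(ν * (t + d + 1 : ℕ))) =
          Real.exp (ν * b) * Real.exp (-(ν * (b + d + 1 + t : ℕ))) := by
        rw [← Real.exp_add]
        congr 1
        push_cast
        ring
      rw [he]
      calc 3 / ε = 1 / 2 * (1 - Real.exp (-ν)) * (6 / (ε * (1 - Real.exp (-ν)))) := by
            field_simp
            norm_num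
        _ ≤ 1 / 2 * (1 - Real.exp (-ν)) * Real.exp (ν * b) := by gcongr
        _ ≤ 1 / 2 * (1 - Real.exp (-ν)) * Real.exp (ν * b) *
            (l * Real.exp (-(ν * (b + d + 1 + t : ℕ)))) :=
            le_mul_of_one_le_right (by positivity) hlow
        _ = l / 2 * ((1 - Real.exp (-ν)) *
            (Real.exp (ν * b) * Real.exp (-(ν * (b + d + 1 + t : ℕ))))) := by ring
        _ ≤ _ := by gcongr
    have h3 : 3 / ε * P.real A ≤ 1 :=
      (mul_le_mul_of_nonneg_right h2 measureReal_nonneg).trans h1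
    rw [div_mul_eq_mul_div, div_le_one hε] at h3
    linarith
  have hB : P.real B ≤ ε / 3 := by
    have h1 := hM.mul_prob_le_card_empty_windows_le t (⌊l⌋₊ + 1) j (l / 2)
    have h2 : ((⌊l⌋₊ + 1 : ℕ) : ℝ) * Real.exp (-(ν * t)) ≤
        2 * Real.exp (ν * (b + d + 2)) := by
      have he : Real.exp (-(ν * t)) =
          Real.exp (ν * (b + d + 1)) * Real.exp (-(ν * (b + d + 1 + t : ℕ))) := by
        rw [← Real.exp_add]
        congr 1
        push_cast
        ring
      have he' : Real.exp (ν * (b + d + 2)) = Real.exp (ν * (b + d + 1)) * Real.exp ν := by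
        rw [← Real.exp_add]
        congr 1
        ring
      rw [he, he']
      calc _ ≤ (2 * l) * (Real.exp (ν * (b + d + 1)) *
            Real.exp (-(ν * (b + d + 1 + t : ℕ)))) := by
            gcongr
            push_cast
            linarith
        _ = 2 * (Real.exp (ν * (b + d + 1)) *
            (l * Real.exp (-(ν * (b + d + 1 + t : ℕ))))) := by ring
        _ ≤ _ := by gcongr
    rw [div_lt_iff₀ hε] at hj
    have h3 : j * P.real B ≤ j * (ε / 3) := by linarith [h1.trans h2]
    exact le_of_mul_le_mul_left h3 hj0
  have hC : P.real C ≤ ε / 3 := by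
    refine (hM.prob_exists_Ico_eq_zero_le r j).trans ?_
    rw [Real.exp_neg, ← div_eq_mul_inv, div_le_iff₀ (Real.exp_pos _)]
    rw [div_le_iff₀ hε] at hr
    linarith
  have hE : P.real E = 0 := by
    rw [measureReal_eq_zero_iff]
    exact ae_iff.1 (hM.ae_forall_rat.and (hM.ae_isDiscreteUnbounded hν))
  have hcover : (Set.univ : Set Ω) ⊆ G ∪ (A ∪ B ∪ C ∪ E) := by
    intro ω _
    by_contra hω
    simp only [Set.mem_union, not_or] at hω
    obtain ⟨hωG, ⟨⟨hωA, hωB⟩, hωC⟩, hωE⟩ := hω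
    obtain ⟨hm, hS⟩ := not_not.1 hωE
    obtain ⟨k, hk, hωk⟩ : ∃ k ∈ Finset.range n,
        ω ∈ chargedThenEmpty M (t + d + 1 : ℕ) (-l / 2 + k) := by
      by_contra! hno
      exact hωA hno
    refine hωG (le_encard_gaps_and_lt_gapOrderStat_sub hm hS hd hjr (by linarith) (k := k)
      ?_ hωk.2 (not_le.1 hωB) fun i hi h0 => hωC ⟨i, hi, h0⟩)
    have : (k : ℝ) + 1 ≤ n := by exact_mod_cast Finset.mem_range.1 hk
    push_cast
    linarith
  -- the event `G` need not be measurable, but subadditivity suffices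
  have h1 : 1 ≤ P.real G + (P.real A + P.real B + P.real C + P.real E) := by
    calc (1 : ℝ) = P.real Set.univ := probReal_univ.symm
      _ ≤ P.real (G ∪ (A ∪ B ∪ C ∪ E)) := measureReal_mono hcover
      _ ≤ P.real G + P.real (A ∪ B ∪ C ∪ E) := measureReal_union_le _ _
      _ ≤ _ := by
        gcongr
        refine (measureReal_union_le _ _).trans ?_
        gcongr
        refine (measureReal_union_le _ _).trans ?_
        gcongr
        exact measureReal_union_le _ _
  linarith
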